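/- For permutations $\pi$ of length $n$ and $\tau$ of length $k$ (in one-line notation), say that $\pi$ contains $\tau$ if there are indices $i_1<\cdots<i_k$ such that $\pi(i_1),\ldots,\pi(i_k)$ is in the same relative order as $\tau$; let $\operatorname{Av}(3124,4312)$ be the set of all permutations, of any length, that contain neither $3124$ nor $4312$. An interval of $\pi$ is a nonempty set of consecutive indices whose entries form a set of consecutive integers, and $\pi$ is simple if its only intervals are those of length $1$ and $n$. For a set $\mathcal{C}$ of permutations, $\operatorname{Si}(\mathcal{C})$ is the set of simple permutations in $\mathcal{C}$. A permutation of length $n$ can be drawn on a set $F\subseteq\mathbb{R}^2$ if there are $n$ points of $F$ with pairwise distinct abscissas and pairwise distinct ordinates which, when they are labelled $1,\ldots,n$ in ascending order from bottom to top and the labels are read from left to right, give that permutation. Let $\mathcal{G}_1$ be the set of permutations that can be drawn on the union of the four closed segments $$(0,0)(1,1),\quad (1,1)(2,0),\quad (1,1)(2,2),\quad (2,2)(3,1),$$ and let $\mathcal{G}_2$ be the set of permutations that can be drawn on the union of the six closed segments $$(0,0)(1,1),\quad (1,1)(2,2),\quad (2,2)(3,1),\quad (3,1)(4,0),\quad (2,3)(3,4),\quad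 (3,2)(4,3).$$ These are the geometric grid classes of the matrices (rows displayed from top to bottom) $$\begin{pmatrix}0&+1&-1\\+1&-1&0\end{pmatrix}\quad\text{and}\quad\begin{pmatrix}0&0&+1&0\\0&0&0&+1\\0&+1&-1&0\\+1&0&0&-1\end{pmatrix}.$$ Theorem. $\operatorname{Si}(\operatorname{Av}(3124,4312))=\operatorname{Si}(\mathcal{G}_1\cup\mathcal{G}_2)$. -/

import Mathlib

namespace PermClass

/-- A permutation of some length `n`, in zero-based one-line notation: positions and
values both range over `Fin n`. -/
abbrev Permutation : Type := Σ n : ℕ, Equiv.Perm (Fin n)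

/-- `Contains π τ` (written `τ ≤ π` in the literature): there are indices
`i₁ < i₂ < ⋯ < iₖ` such that `π i₁, …, π iₖ` is in the same relative order as `τ`. -/
def Contains (π τ : Permutation) : Prop :=
  ∃ f : Fin τ.1 → Fin π.1, StrictMono f ∧
    ∀ i j : Fin τ.1, π.2 (f i) < π.2 (f j) ↔ τ.2 i < τ.2 j

/-- `Av B`: the permutations that contain no member of `B`. -/
def Av (B : Set Permutation) : Set Permutation :=
  {π | ∀ τ ∈ B, ¬ Contains π τ}

/-- The permutation `3124`; the second vector is the inverse permutation. -/
def p3124 : Permutation :=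
  ⟨4, ⟨![2, 0, 1, 3], ![1, 2, 0, 3], by decide, by decide⟩⟩

/-- The permutation `4312`; the second vector is the inverse permutation. -/
def p4312 : Permutation :=
  ⟨4, ⟨![3, 2, 0, 1], ![2, 3, 1, 0], by decide, by decide⟩⟩

/-- A nonempty set of consecutive indices whose set of entries is a set of
consecutive values. -/
def IsInterval (π : Permutation) (I : Finset (Fin π.1)) : Prop :=
  I.Nonempty ∧ (∃ a b : Fin π.1, I = Finset.Icc a b) ∧
    ∃ c d : Fin π.1, I.image π.2 = Finset.Icc c d

/-- A permutation of length `n` is simple if its only intervals have length `1` or `n`. -/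
def IsSimple (π : Permutation) : Prop :=
  ∀ I : Finset (Fin π.1), IsInterval π I → I.card = 1 ∨ I.card = π.1

/-- The simple permutations in a set of permutations. -/
def Si (C : Set Permutation) : Set Permutation :=
  {π | π ∈ C ∧ IsSimple π}

/-- The possible entries `0`, `+1`, `-1`, `•` of the matrix of a geometric grid class. -/
inductive Cell : Type
  | empty
  | inc
  | dec
  | dot

/-- The part of the standard figure in the unit cell with lower left corner `(x, y)`. -/
def Cell.figure (x y : ℝ) : Cell → Set (ℝ × ℝ)
  | .empty => ∅
  | .inc => segment ℝ (x, y) (x + 1, y + 1)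
  | .dec => segment ℝ (x, y + 1) (x + 1, y)
  | .dot => {(x + 1 / 2, y + 1 / 2)}

/-- The standard figure of a matrix. Matrices are indexed with Cartesian coordinates:
first by column from left to right, then by row from bottom to top, starting at `0`. -/
def standardFigure {c r : ℕ} (M : Fin c → Fin r → Cell) : Set (ℝ × ℝ) :=
  ⋃ (k : Fin c) (l : Fin r), (M k l).figure (k : ℕ) (l : ℕ)

/-- `π` can be drawn on `F`: there are points of `F` with distinct abscissas and distinct
ordinates which, numbered from bottom to top and read from left to right, give `π`. Here
`p i` is the `i`-th point from the left. Two entries are never at the same point, so a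
one-point cell receives at most one entry. -/
def CanBeDrawnOn (π : Permutation) (F : Set (ℝ × ℝ)) : Prop :=
  ∃ p : Fin π.1 → ℝ × ℝ, (∀ i, p i ∈ F) ∧ StrictMono (fun i => (p i).1) ∧
    ∀ i j : Fin π.1, (p i).2 < (p j).2 ↔ π.2 i < π.2 j

/-- The geometric grid class of a matrix. -/
def Geom {c r : ℕ} (M : Fin c → Fin r → Cell) : Set Permutation :=
  {π | CanBeDrawnOn π (standardFigure M)}

/-- Three columns and two rows; each inner vector is a column, listed from bottom to top. -/
def M₁ : Fin 3 → Fin 2 → Cell :=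
  ![![.inc, .empty],
    ![.dec, .inc],
    ![.empty, .dec]]

/-- Four columns and four rows; each inner vector is a column, listed from bottom to top. -/
def M₂ : Fin 4 → Fin 4 → Cell :=
  ![![.inc, .empty, .empty, .empty],
    ![.empty, .inc, .empty, .empty],
    ![.empty, .dec, .empty, .inc],
    ![.dec, .empty, .inc, .empty]]

/-- The geometric grid class `𝒢₁`. -/
def G₁ : Set Permutation := Geom M₁

/-- The geometric grid class `𝒢₂`. -/
def G₂ : Set Permutation := Geom M₂

end PermClass

/-!
Both classes `𝒢₁` and `𝒢₂` lie in `Av(3124, 4312)` because no four points of the two figures form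
a forbidden pattern: the figures lie on three, respectively four, lines of slope `±1`, and
each choice of lines is refuted by linear arithmetic (`G₁_subset_Av`, `G₂_subset_Av`).

Conversely, let `π` be a simple permutation of length at least one that avoids both patterns. Let
`z` be its last position, `m` the position of its maximum and `a` the first position whose entry is
at least `π z`. Simplicity is used in the form that every set of at least two but not all entries
is separated, by position or by value, by an entry outside it (`IsSimple.split`).
Applied to suitable rectangles of entries, it gives the following.

* The entries before `a` are increasing (`IsSimpleAvoider.increasing_of_lt_last`).
* If the entries after `m` are decreasing, then the entries up to `m` with value at least `π z` are
  increasing, and cutting the columns at `a` and after `m`, and the rows at `π z`, puts `π` into the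
  cells of `M₁`.
* Otherwise let `q` be the position of the largest entry after `m`. If `q` is not last, then all
  entries strictly between `m` and `q` lie below `π z`, and cutting the columns at `a` and at `q`,
  and the rows at `π z`, again puts `π` into the cells of `M₁`.
* If `q` is last, consider the entries after `a` that are at most `π z` and are the upper end of an
  ascent among such entries. They form an increasing sequence of the topmost values up to `π z`, all
  to the right of `m`; what remains below them after `a` is decreasing. This puts `π` into
  the cells of `M₂`.

Such a gridding yields a drawing since the graphs of rows and columns of `M₁` and `M₂` are
forests: going through the rows and columns along the forest, each next row or column has
coordinates prescribed in at most one of its cells, and these extend to all of it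
(`exists_strictMono_extension`).
-/

namespace PermClass

/-! ### Griddings and drawings -/

/-- `p` is gridded by the monotone cells of `M`: `col` and `row` cut the positions and the values
into consecutive blocks, every entry lies in an increasing or decreasing cell, and the entries of
one cell are monotone as the cell prescribes. Point cells are not allowed, which suffices for
`M₁` and `M₂`. -/
structure IsGridding {ι β : Type*} [LinearOrder ι] [LinearOrder β] {c r : ℕ}
    (M : Fin c → Fin r → Cell) (p : ι → β) (col : ι → Fin c) (row : ι → Fin r) : Prop where
  col_mono : Monotone col
  row_mono : ∀ i j, p i ≤ p j → row i ≤ row j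
  cell : ∀ i, M (col i) (row i) = .inc ∨ M (col i) (row i) = .dec
  inc : ∀ i j, i < j → col i = col j → row i = row j → M (col i) (row i) = .inc → p i < p j
  dec : ∀ i j, i < j → col i = col j → row i = row j → M (col i) (row i) = .dec → p j < p i

/-- A map into an open interval that is increasing (with respect to the injective `key`) on a
subset `s` of a finite set extends to an increasing map on the whole set. -/
theorem exists_strictMono_extension {ι β : Type*} [Finite ι] [LinearOrder β] {key : ι → β}
    (hkey : Function.Injective key) {a b : ℝ} (hab : a < b) (s : Set ι) (f : ι → ℝ)
    (hf : ∀ i ∈ s, f i ∈ Set.Ioo a b)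
    (hmono : ∀ i ∈ s, ∀ j ∈ s, key i < key j → f i < f j) :
    ∃ g : ι → ℝ, (∀ i, g i ∈ Set.Ioo a b) ∧ (∀ i j, key i < key j → g i < g j) ∧
      ∀ i ∈ s, g i = f i := by
  classical
  have := Fintype.ofFinite ι
  suffices H : ∀ t : Finset ι, ∃ g : ι → ℝ, (∀ i, i ∈ s ∨ i ∈ t → g i ∈ Set.Ioo a b) ∧
      (∀ i j, i ∈ s ∨ i ∈ t → j ∈ s ∨ j ∈ t → key i < key j → g i < g j) ∧
      ∀ i ∈ s, g i = f i by
    obtain ⟨g, h1, h2, h3⟩ := H Finset.univ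
    exact ⟨g, fun i => h1 i (by simp), fun i j => h2 i j (by simp) (by simp), h3⟩
  intro t
  induction t using Finset.induction_on with
  | empty => exact ⟨f, by simpa using hf, by simpa using fun i j hi hj => hmono i hi j hj, by simp⟩
  | insert x t _ ih =>
    obtain ⟨g, h1, h2, h3⟩ := ih
    by_cases hxs : x ∈ s
    · refine ⟨g, fun i hi => h1 i ?_, fun i j hi hj => h2 i j ?_ ?_, h3⟩ <;> grind
    · obtain ⟨y, hlo, hhi⟩ := Order.exists_between_finsets
        (lo := insert a ((Finset.univ.filter fun i => (i ∈ s ∨ i ∈ t) ∧ key i < key x).image g))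
        (hi := insert b ((Finset.univ.filter fun i => (i ∈ s ∨ i ∈ t) ∧ key x < key i).image g))
        (by
          intro u hu v hv
          simp only [Finset.mem_insert, Finset.mem_image, Finset.mem_filter, Finset.mem_univ,
            true_and] at hu hv
          rcases hu with rfl | ⟨i, ⟨hi, hix⟩, rfl⟩ <;> rcases hv with rfl | ⟨j, ⟨hj, hjx⟩, rfl⟩
          · exact hab
          · exact (h1 j hj).1
          · exact (h1 i hi).2
          · exact h2 i j hi hj (hix.trans hjx))
      have hne : ∀ i, i ≠ x → key i ≠ key x := fun i hi h => hi (hkey h)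
      have hya := hlo a (by simp)
      have hyb := hhi b (by simp)
      have hlo' : ∀ i, i ∈ s ∨ i ∈ t → key i < key x → g i < y := fun i hi hk =>
        hlo _ (by
          refine Finset.mem_insert_of_mem (Finset.mem_image_of_mem g ?_)
          simp [hi, hk])
      have hhi' : ∀ i, i ∈ s ∨ i ∈ t → key x < key i → y < g i := fun i hi hk =>
        hhi _ (by
          refine Finset.mem_insert_of_mem (Finset.mem_image_of_mem g ?_)
          simp [hi, hk])
      refine ⟨Function.update g x y, fun i hi => ?_, fun i j hi hj hij => ?_, fun i hi => ?_⟩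
      · by_cases hix : i = x
        · subst hix; simp [hya, hyb]
        · rw [Function.update_of_ne hix]
          exact h1 i (by grind)
      · by_cases hix : i = x <;> by_cases hjx : j = x
        · subst hix; subst hjx; exact absurd hij (lt_irrefl _)
        · subst hix
          rw [Function.update_self, Function.update_of_ne hjx]
          exact hhi' j (by grind) hij
        · subst hjx
          rw [Function.update_self, Function.update_of_ne hix]
          exact hlo' i (by grind) hij
        · rw [Function.update_of_ne hix, Function.update_of_ne hjx]
          exact h2 i j (by grind) (by grind) hij
      · rw [Function.update_of_ne (by rintro rfl; exact hxs hi)]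
        exact h3 i hi

theorem mem_inc_figure {a b x y : ℝ} (h0 : a ≤ x) (h1 : x ≤ a + 1) (h : y - b = x - a) :
    (x, y) ∈ Cell.figure a b .inc := by
  refine ⟨1 - (x - a), x - a, by linarith, by linarith, by ring, ?_⟩
  ext
  · simp only [Prod.fst_add, Prod.smul_fst, smul_eq_mul]
    ring
  · simp only [Prod.snd_add, Prod.smul_snd, smul_eq_mul]
    linear_combination -h

theorem mem_dec_figure {a b x y : ℝ} (h0 : a ≤ x) (h1 : x ≤ a + 1) (h : y - b = 1 - (x - a)) :
    (x, y) ∈ Cell.figure a b .dec := by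
  refine ⟨1 - (x - a), x - a, by linarith, by linarith, by ring, ?_⟩
  ext
  · simp only [Prod.fst_add, Prod.smul_fst, smul_eq_mul]
    ring
  · simp only [Prod.snd_add, Prod.smul_snd, smul_eq_mul]
    linear_combination -h

/-- A gridding is realized in the standard figure once coordinates are found that are increasing
within each column and each row and satisfy the equation of the segment in each cell. -/
theorem IsGridding.mem_geom {π : Permutation} {c r : ℕ} {M : Fin c → Fin r → Cell}
    {col : Fin π.1 → Fin c} {row : Fin π.1 → Fin r} (hg : IsGridding M π.2 col row)
    (X Y : Fin π.1 → ℝ)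
    (hX : ∀ i, X i ∈ Set.Ioo ((col i : ℕ) : ℝ) ((col i : ℕ) + 1))
    (hY : ∀ i, Y i ∈ Set.Ioo ((row i : ℕ) : ℝ) ((row i : ℕ) + 1))
    (hXm : ∀ i j, i < j → col i = col j → X i < X j)
    (hYm : ∀ i j, π.2 i < π.2 j → row i = row j → Y i < Y j)
    (hinc : ∀ i, M (col i) (row i) = .inc → Y i - (row i : ℕ) = X i - (col i : ℕ))
    (hdec : ∀ i, M (col i) (row i) = .dec → Y i - (row i : ℕ) = 1 - (X i - (col i : ℕ))) :
    π ∈ Geom M := by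
  have hY' : ∀ i j, π.2 i < π.2 j → Y i < Y j := by
    intro i j hij
    rcases (hg.row_mono i j hij.le).eq_or_lt with h | h
    · exact hYm i j hij h
    · have h' : ((row i : ℕ) : ℝ) + 1 ≤ (row j : ℕ) := by exact_mod_cast h
      linarith [(hY i).2, (hY j).1]
  refine ⟨fun i => (X i, Y i), fun i => ?_, fun i j hij => ?_, fun i j => ⟨fun h => ?_, hY' i j⟩⟩
  · refine Set.mem_iUnion₂.2 ⟨col i, row i, ?_⟩
    rcases hg.cell i with h | h <;> rw [h]
    · exact mem_inc_figure (hX i).1.le (hX i).2.le (hinc i h)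
    · exact mem_dec_figure (hX i).1.le (hX i).2.le (hdec i h)
  · change X i < X j
    rcases (hg.col_mono hij.le).eq_or_lt with h | h
    · exact hXm i j hij h
    · have h' : ((col i : ℕ) : ℝ) + 1 ≤ (col j : ℕ) := by exact_mod_cast h
      linarith [(hX i).2, (hX j).1]
  · by_contra hn
    rcases (not_lt.1 hn).eq_or_lt with h' | h'
    · have := π.2.injective h'
      subst this
      exact lt_irrefl _ h
    · exact lt_asymm h (hY' j i h')

theorem M₁_cells {k : Fin 3} {l : Fin 2} (h : M₁ k l = .inc ∨ M₁ k l = .dec) :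
    k = 0 ∧ l = 0 ∨ k = 1 ∧ l = 0 ∨ k = 1 ∧ l = 1 ∨ k = 2 ∧ l = 1 := by
  fin_cases k <;> fin_cases l <;> simp_all [M₁]

theorem M₂_cells {k : Fin 4} {l : Fin 4} (h : M₂ k l = .inc ∨ M₂ k l = .dec) :
    k = 0 ∧ l = 0 ∨ k = 3 ∧ l = 0 ∨ k = 1 ∧ l = 1 ∨ k = 2 ∧ l = 1 ∨ k = 3 ∧ l = 2 ∨
      k = 2 ∧ l = 3 := by
  fin_cases k <;> fin_cases l <;> simp_all [M₂]

/-- The nonzero cells of `M₁` form a path: coordinates are chosen for the lower row, and then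
extended in turn to the middle column and to the upper row. -/
theorem IsGridding.mem_G₁ {π : Permutation} {col : Fin π.1 → Fin 3} {row : Fin π.1 → Fin 2}
    (hg : IsGridding M₁ π.2 col row) : π ∈ G₁ := by
  have hpos := Function.injective_id (α := Fin π.1)
  have hval := π.2.injective
  have hcell := fun i => M₁_cells (hg.cell i)
  obtain ⟨y0, hy0, my0, -⟩ := exists_strictMono_extension hval zero_lt_one ∅ (fun _ => 0)
    (by simp) (by simp)
  obtain ⟨x1, hx1, mx1, ex1⟩ := exists_strictMono_extension hpos (one_lt_two (α := ℝ))
    {i | col i = 1 ∧ row i = 0} (fun i => 2 - y0 i)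
    (fun i _ => ⟨by linarith [(hy0 i).2], by linarith [(hy0 i).1]⟩)
    (fun i hi j hj hij => by
      have := hg.dec i j hij (hi.1.trans hj.1.symm) (hi.2.trans hj.2.symm)
        (by rw [hi.1, hi.2]; rfl)
      linarith [my0 _ _ this])
  obtain ⟨y1, hy1, my1, ey1⟩ := exists_strictMono_extension hval (one_lt_two (α := ℝ))
    {i | col i = 1 ∧ row i = 1} x1 (fun i _ => hx1 i)
    (fun i hi j hj hij => by
      refine mx1 i j (lt_of_not_ge fun hji => ?_)
      rcases hji.eq_or_lt with rfl | hji
      · exact lt_irrefl _ hij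
      · exact lt_asymm hij (hg.inc j i hji (hj.1.trans hi.1.symm) (hj.2.trans hi.2.symm)
          (by rw [hj.1, hj.2]; rfl)))
  refine hg.mem_geom (fun i => if col i = 0 then y0 i else if col i = 1 then x1 i else 4 - y1 i)
    (fun i => if row i = 0 then y0 i else y1 i) (fun i => ?_) (fun i => ?_)
    (fun i j hij hc => ?_) (fun i j hij hr => ?_) (fun i hi => ?_) (fun i hi => ?_)
  · rcases hcell i with ⟨h, h'⟩ | ⟨h, h'⟩ | ⟨h, h'⟩ | ⟨h, h'⟩ <;>
      constructor <;> simp [h] <;> linarith [(hy0 i).1, (hy0 i).2, (hx1 i).1, (hx1 i).2,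
        (hy1 i).1, (hy1 i).2]
  · rcases hcell i with ⟨h, h'⟩ | ⟨h, h'⟩ | ⟨h, h'⟩ | ⟨h, h'⟩ <;>
      constructor <;> simp [h'] <;> linarith [(hy0 i).1, (hy0 i).2, (hy1 i).1, (hy1 i).2]
  · have hI := hg.inc i j hij hc
    have hD := hg.dec i j hij hc
    have m1 := mx1 i j hij
    rcases hcell i with ⟨h, h'⟩ | ⟨h, h'⟩ | ⟨h, h'⟩ | ⟨h, h'⟩ <;>
      rcases hcell j with ⟨k, k'⟩ | ⟨k, k'⟩ | ⟨k, k'⟩ | ⟨k, k'⟩ <;>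
      simp [h, h', k, k'] at hc hI hD ⊢ <;> try assumption
    · exact my0 _ _ (hI rfl)
    · exact my1 _ _ (hD rfl)
  · by_cases h : row i = 0
    · simpa [h, ← hr] using my0 i j hij
    · simpa [h, ← hr] using my1 i j hij
  · rcases hcell i with ⟨h, h'⟩ | ⟨h, h'⟩ | ⟨h, h'⟩ | ⟨h, h'⟩ <;> simp_all [M₁]
  · rcases hcell i with ⟨h, h'⟩ | ⟨h, h'⟩ | ⟨h, h'⟩ | ⟨h, h'⟩ <;> simp_all [M₁]
    all_goals linarith

/-- The nonzero cells of `M₂` form two paths, through the rows `0`, `2` and the columns `0`, `3`,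
and through the rows `1`, `3` and the columns `1`, `2`; coordinates are chosen independently along
each of them. -/
theorem IsGridding.mem_G₂ {π : Permutation} {col : Fin π.1 → Fin 4} {row : Fin π.1 → Fin 4}
    (hg : IsGridding M₂ π.2 col row) : π ∈ G₂ := by
  have hpos := Function.injective_id (α := Fin π.1)
  have hval := π.2.injective
  have hcell := fun i => M₂_cells (hg.cell i)
  obtain ⟨y0, hy0, my0, -⟩ := exists_strictMono_extension hval zero_lt_one ∅ (fun _ => 0)
    (by simp) (by simp)
  obtain ⟨y1, hy1, my1, -⟩ := exists_strictMono_extension hval (one_lt_two (α := ℝ)) ∅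
    (fun _ => 0) (by simp) (by simp)
  obtain ⟨x2, hx2, mx2, ex2⟩ := exists_strictMono_extension hpos (a := 2) (b := 3) (by norm_num)
    {i | col i = 2 ∧ row i = 1} (fun i => 4 - y1 i)
    (fun i _ => ⟨by linarith [(hy1 i).2], by linarith [(hy1 i).1]⟩)
    (fun i hi j hj hij => by
      have := hg.dec i j hij (hi.1.trans hj.1.symm) (hi.2.trans hj.2.symm)
        (by rw [hi.1, hi.2]; rfl)
      linarith [my1 _ _ this])
  obtain ⟨x3, hx3, mx3, ex3⟩ := exists_strictMono_extension hpos (a := 3) (b := 4) (by norm_num)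
    {i | col i = 3 ∧ row i = 0} (fun i => 4 - y0 i)
    (fun i _ => ⟨by linarith [(hy0 i).2], by linarith [(hy0 i).1]⟩)
    (fun i hi j hj hij => by
      have := hg.dec i j hij (hi.1.trans hj.1.symm) (hi.2.trans hj.2.symm)
        (by rw [hi.1, hi.2]; rfl)
      linarith [my0 _ _ this])
  have hinc : ∀ i j, π.2 i < π.2 j → col i = col j → row i = row j →
      M₂ (col i) (row i) = .inc → i < j := by
    intro i j hij hc hr hM
    refine lt_of_not_ge fun hji => ?_
    rcases hji.eq_or_lt with rfl | hji
    · exact lt_irrefl _ hij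
    · exact lt_asymm hij (hg.inc j i hji hc.symm hr.symm (by rw [← hc, ← hr]; exact hM))
  refine hg.mem_geom
    (fun i => if col i = 0 then y0 i else if col i = 1 then y1 i else
      if col i = 2 then x2 i else x3 i)
    (fun i => if row i = 0 then y0 i else if row i = 1 then y1 i else
      if row i = 2 then x3 i - 1 else x2 i + 1) (fun i => ?_) (fun i => ?_)
    (fun i j hij hc => ?_) (fun i j hij hr => ?_) (fun i hi => ?_) (fun i hi => ?_)
  · rcases hcell i with ⟨h, h'⟩ | ⟨h, h'⟩ | ⟨h, h'⟩ | ⟨h, h'⟩ | ⟨h, h'⟩ | ⟨h, h'⟩ <;>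
      constructor <;> simp [h] <;> linarith [(hy0 i).1, (hy0 i).2, (hy1 i).1, (hy1 i).2,
        (hx2 i).1, (hx2 i).2, (hx3 i).1, (hx3 i).2]
  · rcases hcell i with ⟨h, h'⟩ | ⟨h, h'⟩ | ⟨h, h'⟩ | ⟨h, h'⟩ | ⟨h, h'⟩ | ⟨h, h'⟩ <;>
      constructor <;> simp [h'] <;> linarith [(hy0 i).1, (hy0 i).2, (hy1 i).1, (hy1 i).2,
        (hx2 i).1, (hx2 i).2, (hx3 i).1, (hx3 i).2]
  · have hI := hg.inc i j hij hc
    have m2 := mx2 i j hij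
    have m3 := mx3 i j hij
    rcases hcell i with ⟨h, h'⟩ | ⟨h, h'⟩ | ⟨h, h'⟩ | ⟨h, h'⟩ | ⟨h, h'⟩ | ⟨h, h'⟩ <;>
      rcases hcell j with ⟨k, k'⟩ | ⟨k, k'⟩ | ⟨k, k'⟩ | ⟨k, k'⟩ | ⟨k, k'⟩ | ⟨k, k'⟩ <;>
      simp [h, h', k, k'] at hc hI ⊢ <;> try assumption
    · exact my0 _ _ (hI rfl)
    · exact my1 _ _ (hI rfl)
  · have hI := hinc i j hij
    have m0 := my0 i j hij
    have m1 := my1 i j hij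
    rcases hcell i with ⟨h, h'⟩ | ⟨h, h'⟩ | ⟨h, h'⟩ | ⟨h, h'⟩ | ⟨h, h'⟩ | ⟨h, h'⟩ <;>
      rcases hcell j with ⟨k, k'⟩ | ⟨k, k'⟩ | ⟨k, k'⟩ | ⟨k, k'⟩ | ⟨k, k'⟩ | ⟨k, k'⟩ <;>
      simp [h, h', k, k'] at hr hI ⊢ <;> try assumption
    · exact mx3 _ _ (hI rfl)
    · exact mx2 _ _ (hI rfl)
  · rcases hcell i with ⟨h, h'⟩ | ⟨h, h'⟩ | ⟨h, h'⟩ | ⟨h, h'⟩ | ⟨h, h'⟩ | ⟨h, h'⟩ <;>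
      simp_all [M₂]
    all_goals linarith
  · rcases hcell i with ⟨h, h'⟩ | ⟨h, h'⟩ | ⟨h, h'⟩ | ⟨h, h'⟩ | ⟨h, h'⟩ | ⟨h, h'⟩ <;>
      simp_all [M₂]
    all_goals linarith

/-! ### The two figures avoid both patterns -/

theorem of_mem_inc_figure {a b : ℝ} {q : ℝ × ℝ} (h : q ∈ Cell.figure a b .inc) :
    a ≤ q.1 ∧ q.1 ≤ a + 1 ∧ q.2 - b = q.1 - a := by
  obtain ⟨s, t, hs, ht, hst, rfl⟩ := h
  obtain rfl : s = 1 - t := by linarith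
  simp
  refine ⟨?_, ?_, ?_⟩ <;> nlinarith

theorem of_mem_dec_figure {a b : ℝ} {q : ℝ × ℝ} (h : q ∈ Cell.figure a b .dec) :
    a ≤ q.1 ∧ q.1 ≤ a + 1 ∧ q.2 - b = 1 - (q.1 - a) := by
  obtain ⟨s, t, hs, ht, hst, rfl⟩ := h
  obtain rfl : s = 1 - t := by linarith
  simp
  refine ⟨?_, ?_, ?_⟩ <;> nlinarith

theorem mem_standardFigure_M₁ {q : ℝ × ℝ} (h : q ∈ standardFigure M₁) :
    0 ≤ q.1 ∧ q.1 ≤ 2 ∧ q.2 = q.1 ∨ 1 ≤ q.1 ∧ q.1 ≤ 2 ∧ q.2 = 2 - q.1 ∨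
      2 ≤ q.1 ∧ q.1 ≤ 3 ∧ q.2 = 4 - q.1 := by
  obtain ⟨k, l, h⟩ := Set.mem_iUnion₂.1 h
  fin_cases k <;> fin_cases l <;>
    first
    | exact h.elim
    | (have h := of_mem_inc_figure h; norm_num at h; grind)
    | (have h := of_mem_dec_figure h; norm_num at h; grind)

theorem mem_standardFigure_M₂ {q : ℝ × ℝ} (h : q ∈ standardFigure M₂) :
    0 ≤ q.1 ∧ q.1 ≤ 2 ∧ q.2 = q.1 ∨ 2 ≤ q.1 ∧ q.1 ≤ 4 ∧ q.2 = 4 - q.1 ∨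
      2 ≤ q.1 ∧ q.1 ≤ 3 ∧ q.2 = q.1 + 1 ∨ 3 ≤ q.1 ∧ q.1 ≤ 4 ∧ q.2 = q.1 - 1 := by
  obtain ⟨k, l, h⟩ := Set.mem_iUnion₂.1 h
  fin_cases k <;> fin_cases l <;>
    first
    | exact h.elim
    | (have h := of_mem_inc_figure h; norm_num at h; grind)
    | (have h := of_mem_dec_figure h; norm_num at h; grind)

theorem contains_p3124_iff {π : Permutation} : Contains π p3124 ↔
    ∃ i j k l, i < j ∧ j < k ∧ k < l ∧ π.2 j < π.2 k ∧ π.2 k < π.2 i ∧ π.2 i < π.2 l := by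
  constructor
  · rintro ⟨f, hf, h⟩
    exact ⟨f (0 : Fin 4), f (1 : Fin 4), f (2 : Fin 4), f (3 : Fin 4), hf (by decide),
      hf (by decide), hf (by decide), (h _ _).2 (by decide), (h _ _).2 (by decide),
      (h _ _).2 (by decide)⟩
  · rintro ⟨i, j, k, l, hij, hjk, hkl, h1, h2, h3⟩
    refine ⟨(![i, j, k, l] : Fin 4 → _), Fin.strictMono_iff_lt_succ.2 ?_, ?_⟩
    · intro x
      fin_cases x <;> simpa
    · intro (x : Fin 4) (y : Fin 4)
      fin_cases x <;> fin_cases y <;> first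
        | (refine iff_of_true ?_ (by decide); simp; order)
        | (refine iff_of_false ?_ (by decide); simp; done)
        | (refine iff_of_false ?_ (by decide); simp; order)

theorem contains_p4312_iff {π : Permutation} : Contains π p4312 ↔
    ∃ i j k l, i < j ∧ j < k ∧ k < l ∧ π.2 k < π.2 l ∧ π.2 l < π.2 j ∧ π.2 j < π.2 i := by
  constructor
  · rintro ⟨f, hf, h⟩
    exact ⟨f (0 : Fin 4), f (1 : Fin 4), f (2 : Fin 4), f (3 : Fin 4), hf (by decide),
      hf (by decide), hf (by decide), (h _ _).2 (by decide), (h _ _).2 (by decide),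
      (h _ _).2 (by decide)⟩
  · rintro ⟨i, j, k, l, hij, hjk, hkl, h1, h2, h3⟩
    refine ⟨(![i, j, k, l] : Fin 4 → _), Fin.strictMono_iff_lt_succ.2 ?_, ?_⟩
    · intro x
      fin_cases x <;> simpa
    · intro (x : Fin 4) (y : Fin 4)
      fin_cases x <;> fin_cases y <;> first
        | (refine iff_of_true ?_ (by decide); simp; order)
        | (refine iff_of_false ?_ (by decide); simp; done)
        | (refine iff_of_false ?_ (by decide); simp; order)

theorem mem_Av_of_canBeDrawnOn {π : Permutation} {F : Set (ℝ × ℝ)} (hπ : CanBeDrawnOn π F)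
    (h3124 : ∀ q₁ ∈ F, ∀ q₂ ∈ F, ∀ q₃ ∈ F, ∀ q₄ ∈ F, q₁.1 < q₂.1 → q₂.1 < q₃.1 → q₃.1 < q₄.1 →
      q₂.2 < q₃.2 → q₃.2 < q₁.2 → q₁.2 < q₄.2 → False)
    (h4312 : ∀ q₁ ∈ F, ∀ q₂ ∈ F, ∀ q₃ ∈ F, ∀ q₄ ∈ F, q₁.1 < q₂.1 → q₂.1 < q₃.1 → q₃.1 < q₄.1 →
      q₃.2 < q₄.2 → q₄.2 < q₂.2 → q₂.2 < q₁.2 → False) :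
    π ∈ Av {p3124, p4312} := by
  obtain ⟨q, hq, hx, hy⟩ := hπ
  rintro τ (rfl | rfl) hτ
  · obtain ⟨i, j, k, l, hij, hjk, hkl, h1, h2, h3⟩ := contains_p3124_iff.1 hτ
    exact h3124 _ (hq i) _ (hq j) _ (hq k) _ (hq l) (hx hij) (hx hjk) (hx hkl)
      ((hy _ _).2 h1) ((hy _ _).2 h2) ((hy _ _).2 h3)
  · obtain ⟨i, j, k, l, hij, hjk, hkl, h1, h2, h3⟩ := contains_p4312_iff.1 hτ
    exact h4312 _ (hq i) _ (hq j) _ (hq k) _ (hq l) (hx hij) (hx hjk) (hx hkl)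
      ((hy _ _).2 h1) ((hy _ _).2 h2) ((hy _ _).2 h3)

theorem G₁_subset_Av : G₁ ⊆ Av {p3124, p4312} := by
  refine fun π hπ => mem_Av_of_canBeDrawnOn hπ ?_ ?_ <;>
    intro q₁ h₁ q₂ h₂ q₃ h₃ q₄ h₄ hx₁ hx₂ hx₃ hy₁ hy₂ hy₃ <;>
    rcases mem_standardFigure_M₁ h₂ with h₂ | h₂ | h₂ <;>
    rcases mem_standardFigure_M₁ h₃ with h₃ | h₃ | h₃ <;> (try (exfalso; linarith)) <;>
    rcases mem_standardFigure_M₁ h₁ with h₁ | h₁ | h₁ <;> (try (exfalso; linarith)) <;>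
    rcases mem_standardFigure_M₁ h₄ with h₄ | h₄ | h₄ <;> linarith

theorem G₂_subset_Av : G₂ ⊆ Av {p3124, p4312} := by
  refine fun π hπ => mem_Av_of_canBeDrawnOn hπ ?_ ?_ <;>
    intro q₁ h₁ q₂ h₂ q₃ h₃ q₄ h₄ hx₁ hx₂ hx₃ hy₁ hy₂ hy₃ <;>
    rcases mem_standardFigure_M₂ h₂ with h₂ | h₂ | h₂ | h₂ <;>
    rcases mem_standardFigure_M₂ h₃ with h₃ | h₃ | h₃ | h₃ <;> (try (exfalso; linarith)) <;>
    rcases mem_standardFigure_M₂ h₁ with h₁ | h₁ | h₁ | h₁ <;> (try (exfalso; linarith)) <;>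
    rcases mem_standardFigure_M₂ h₄ with h₄ | h₄ | h₄ | h₄ <;> linarith

/-! ### From conditions on entries to griddings -/

/-- A gridding by `M₁` from a first column ending before `a`, a last column `C` and a value `c` at
which the rows are cut. -/
theorem exists_isGridding_M₁ {ι β : Type*} [LinearOrder ι] [LinearOrder β] {p : ι → β} {a : ι}
    {c : β} (C : ι → Prop) (hC : ∀ i j, i ≤ j → C i → C j)
    (h0 : ∀ i, i < a → p i < c) (h2 : ∀ i, C i → c ≤ p i)
    (hinc0 : ∀ i j, i < j → j < a → p i < p j)
    (hdec1 : ∀ i j, a ≤ i → i < j → ¬ C j → p i < c → p j < c → p j < p i)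
    (hinc1 : ∀ i j, a ≤ i → i < j → ¬ C j → c ≤ p i → c ≤ p j → p i < p j)
    (hdec2 : ∀ i j, C i → i < j → p j < p i) :
    ∃ col row, IsGridding M₁ p col row := by
  classical
  refine ⟨fun k => if k < a then 0 else if C k then 2 else 1,
    fun k => if p k < c then 0 else 1, ?_, ?_, ?_, ?_, ?_⟩
  · intro i j hij
    dsimp only
    split_ifs <;> first | decide | grind
  · intro i j hij
    split_ifs <;> first | decide | grind
  · intro i
    split_ifs <;> first | (left; rfl) | (right; rfl) | grind
  all_goals
    intro i j hij hc hr hM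
    split_ifs at hc hr hM <;> first
      | (exfalso; revert hc; decide)
      | (exfalso; revert hr; decide)
      | (exfalso; revert hM; simp [M₁]; done)
      | grind

/-- A gridding by `M₂` from columns cut at `a` and after `m`, and from rows cut at `h` and above
`c`. The predicate `low` selects the bottom row; before `a` it also separates the first two columns.
-/
theorem exists_isGridding_M₂ {ι β : Type*} [LinearOrder ι] [LinearOrder β] {p : ι → β} {m a : ι}
    {c h : β} (low : ι → Prop) (hhc : h ≤ c)
    (hlow : ∀ i j, p i ≤ p j → low j → low i) (hlowh : ∀ i, low i → p i < h)
    (h0 : ∀ i, i < a → p i < h) (h2 : ∀ i, a ≤ i → i ≤ m → ¬ low i ∧ (p i < h ∨ c < p i))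
    (h3 : ∀ i, m < i → p i ≤ c ∧ (p i < h → low i))
    (hinc0 : ∀ i j, i < j → j < a → p i < p j)
    (hdec2 : ∀ i j, a ≤ i → i < j → j ≤ m → p i < h → p j < h → p j < p i)
    (hinc2 : ∀ i j, a ≤ i → i < j → j ≤ m → c < p i → c < p j → p i < p j)
    (hdec3 : ∀ i j, m < i → i < j → p i < h → p j < h → p j < p i)
    (hinc3 : ∀ i j, m < i → i < j → h ≤ p i → h ≤ p j → p i < p j) :
    ∃ col row, IsGridding M₂ p col row := by
  classical
  obtain ⟨col, hcol⟩ : ∃ col : ι → Fin 4, ∀ k, col k =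
      if m < k then 3 else if a ≤ k then 2 else if low k then 0 else 1 := ⟨_, fun _ => rfl⟩
  obtain ⟨row, hrow⟩ : ∃ row : ι → Fin 4, ∀ k, row k =
      if low k then 0 else if p k < h then 1 else if p k ≤ c then 2 else 3 := ⟨_, fun _ => rfl⟩
  have hcell : ∀ k, k < a ∧ col k = 0 ∧ row k = 0 ∨ k < a ∧ col k = 1 ∧ row k = 1 ∨
      (a ≤ k ∧ k ≤ m ∧ p k < h) ∧ col k = 2 ∧ row k = 1 ∨
      (a ≤ k ∧ k ≤ m ∧ c < p k) ∧ col k = 2 ∧ row k = 3 ∨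
      (m < k ∧ p k < h) ∧ col k = 3 ∧ row k = 0 ∨ (m < k ∧ h ≤ p k) ∧ col k = 3 ∧ row k = 2 := by
    intro k
    have := h0 k
    have := h2 k
    have := h3 k
    have := hlowh k
    rw [hcol, hrow]
    split_ifs <;> simp <;> grind +splitImp
  refine ⟨col, row, ?_, ?_, ?_, ?_, ?_⟩
  · intro i j hij
    have := hinc0 i j
    have := hlow i j
    rw [hcol, hcol]
    split_ifs <;> first | decide | grind
  · intro i j hij
    have := hlow i j hij
    rw [hrow, hrow]
    split_ifs <;> first | decide | grind
  · intro i
    rcases hcell i with ⟨-, h, h'⟩ | ⟨-, h, h'⟩ | ⟨-, h, h'⟩ | ⟨-, h, h'⟩ | ⟨-, h, h'⟩ |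
      ⟨-, h, h'⟩ <;> simp [h, h', M₂]
  all_goals
    intro i j hij hc hr hM
    rcases hcell i with ⟨hi, h, h'⟩ | ⟨hi, h, h'⟩ | ⟨hi, h, h'⟩ | ⟨hi, h, h'⟩ | ⟨hi, h, h'⟩ |
      ⟨hi, h, h'⟩ <;> simp [h, h', M₂] at hM <;>
    rcases hcell j with ⟨hj, k, k'⟩ | ⟨hj, k, k'⟩ | ⟨hj, k, k'⟩ | ⟨hj, k, k'⟩ | ⟨hj, k, k'⟩ |
      ⟨hj, k, k'⟩ <;> simp [h, h', k, k'] at hc hr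
  · exact hinc0 i j hij hj
  · exact hinc0 i j hij hj
  · exact hinc2 i j hi.1 hij hj.2.1 hi.2.2 hj.2.2
  · exact hinc3 i j hi.1 hij hi.2 hj.2
  · exact hdec2 i j hi.1 hij hj.2.1 hi.2.2 hj.2.2
  · exact hdec3 i j hi.1 hij hi.2 hj.2

/-! ### Simple permutations avoiding both patterns -/

/-- The one-line notation `p` avoids `3124` and `4312` and is simple. Simplicity is expressed by the
field `split`: a set `S` of at least two but not all entries is not an interval, so it is separated
by an entry outside `S` lying strictly between two entries of `S` in position or in value. -/
structure IsSimpleAvoider {ι β : Type*} [LinearOrder ι] [LinearOrder β] (p : ι → β) : Prop where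
  inj : Function.Injective p
  av3124 : ∀ i j k l, i < j → j < k → k < l → p j < p k → p k < p i → p i < p l → False
  av4312 : ∀ i j k l, i < j → j < k → k < l → p k < p l → p l < p j → p j < p i → False
  split : ∀ (S : ι → Prop) (i j t : ι), S i → S j → i ≠ j → ¬ S t →
    ∃ k, ¬ S k ∧ ∃ a b, S a ∧ S b ∧ (a < k ∧ k < b ∨ p a < p k ∧ p k < p b)

namespace IsSimpleAvoider

variable {ι β : Type*} [LinearOrder ι] [LinearOrder β] {p : ι → β} {m q u z a : ι}

/-- If the entries before `a` are smaller than the last entry, then they are increasing: if `p j`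
were the lower end of a descent, the entries up to `j` with value at least `p j` would be an
interval, since an entry separating them completes a `3124` with the last entry. -/
theorem increasing_of_lt_last (hp : IsSimpleAvoider p) (hz : ∀ i, i ≤ z)
    (ha : ∀ i, i < a → p i < p z) {i j : ι} (hij : i < j) (hja : j < a) : p i < p j := by
  have inj := hp.inj
  by_contra hn
  obtain ⟨k, hk, s, t, hs, ht, h | h⟩ := hp.split
      (fun k => k ≤ j ∧ p j ≤ p k) i j z (by grind +splitImp)
    (by grind +splitImp) (by grind +splitImp) (by grind +splitImp)
  · have := hp.av3124 s k j z
    have := hz j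
    grind +splitImp
  · have := hp.av3124 t j k z
    have := hz k
    grind +splitImp

/-- If the entries after the maximum are decreasing, then those up to the maximum and at least as
large as the last entry are increasing. -/
theorem increasing_before_max (hp : IsSimpleAvoider p) [Finite ι] (hz : ∀ i, i ≤ z)
    (hm : ∀ i, p i ≤ p m) (hR : ∀ i j, m < i → i < j → p j < p i) {i j : ι} (hij : i < j)
    (hjm : j ≤ m) (hi : p z ≤ p i) (hj : p z ≤ p j) : p i < p j := by
  have inj := hp.inj
  have hzm := hz m
  by_contra hn
  by_cases hne : ∃ k, p k < p z
  swap
  · -- the last entry is the minimum, so the other entries form an interval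
    obtain ⟨k, hk, s, t, hs, ht, h⟩ := hp.split
      (fun k => k ≠ z) i j z (by grind +splitImp) (by grind +splitImp) (by grind +splitImp)
      (by grind +splitImp)
    have := hz t
    grind +splitImp
  -- `v` is the last position of an entry below `p z`; both `i` and `j` lie after it
  obtain ⟨v, hv, hvmax⟩ := Set.exists_max_image {k | p k < p z} id (Set.toFinite _) hne
  simp only [Set.mem_ofPred_eq, id] at hv hvmax
  have hvm : v < m := by
    have := hR v z
    have := hz v
    grind +splitImp
  have hvj : v < j := by
    have := hp.av4312 i j v z
    grind +splitImp
  have hvi : v < i := by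
    have := hp.av3124 i v j m
    grind +splitImp
  by_cases hx : ∃ x, x < v ∧ p z ≤ p x
  swap
  · -- the entries after `v` are all the entries `≥ p z`, hence an interval
    obtain ⟨k, hk, s, t, hs, ht, h⟩ := hp.split
      (fun k => v < k) i j v (by grind +splitImp) (by grind +splitImp) (by grind +splitImp)
      (by grind +splitImp)
    grind +splitImp
  -- the entries larger than `p x` form an interval: they lie after `v`, and those after `m` come
  -- before the smaller ones there
  obtain ⟨x, hx, hxmax⟩ := Set.exists_max_image {x | x < v ∧ p z ≤ p x} p (Set.toFinite _) hx
  simp only [Set.mem_ofPred_eq] at hx hxmax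
  have key : ∀ y, v < y → y ≤ m → p x < p y := by
    intro y hvy hym
    have := hp.av3124 x v y m
    grind +splitImp
  obtain ⟨k, hk, s, t, hs, ht, h⟩ := hp.split
      (fun k => p x < p k) i j v (by grind +splitImp) (by grind +splitImp)
    (by grind +splitImp) (by grind +splitImp)
  have := hR k t
  have := key k
  have := hxmax s
  grind +splitImp

/-- The case in which the entries after the maximum are decreasing. -/
theorem exists_isGridding_of_decreasing (hp : IsSimpleAvoider p) [Finite ι] (hz : ∀ i, i ≤ z)
    (hm : ∀ i, p i ≤ p m) (hR : ∀ i j, m < i → i < j → p j < p i)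
    (ha : ∀ i, i < a → p i < p z) (hza : p z ≤ p a) :
    ∃ col row, IsGridding M₁ p col row := by
  have hpre := @increasing_of_lt_last _ _ _ _ _ _ _ hp hz ha
  have hinc := @increasing_before_max _ _ _ _ _ _ _ hp _ hz hm hR
  have inj := hp.inj
  have ham : a ≤ m := by
    by_contra h
    have := ha m
    have := hm z
    grind +splitImp
  have hRz : ∀ k, m < k → p z ≤ p k := by
    intro k hk
    have := hR k z
    have := hz k
    grind +splitImp
  have hdec : ∀ i j, a ≤ i → i < j → j ≤ m → p i < p z → p j < p z → p j < p i := by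
    intro i j
    have := hp.av3124 a i j m
    grind +splitImp
  exact exists_isGridding_M₁ (a := a) (c := p z) (fun k => m < k) (by grind) ha hRz
    (fun i j => hpre) (by grind) (by grind) hR

/-- If `p q` is the largest entry after the maximum, then no `132` whose `3` is after the maximum
ends before `q`, provided the `1` is after the maximum too, or exceeds the entries between itself
and the maximum that are at most `p q`: otherwise the entries after the `1` and the maximum, up to
the `2`, with value at least the `2`, form an interval. -/
theorem false_of_132 (hp : IsSimpleAvoider p) (hm : ∀ i, p i ≤ p m) (hq : ∀ i, m < i → p i ≤ p q)
    {b x y : ι} (hmx : m < x) (hbx : b < x) (hxy : x < y) (hyq : y < q) (hby : p b < p y)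
    (hyx : p y < p x) (hb : ∀ k, b < k → k ≤ m → p k ≤ p q → p k < p b) : False := by
  have inj := hp.inj
  obtain ⟨k, hk, s, t, hs, ht, h | h⟩ := hp.split
    (fun k => b < k ∧ m < k ∧ k ≤ y ∧ p y ≤ p k) x y q (by grind) (by grind) (by grind) (by grind)
  · have := hp.av3124 s k y q
    have := hq s
    grind +splitImp
  · have := hp.av4312 m t y k
    have := hp.av3124 k b y q
    have := hb k
    have := hq t
    have := hq x
    have := hm t
    have := hm x
    grind +splitImp

theorem decreasing_after (hp : IsSimpleAvoider p) (hm : ∀ i, p i ≤ p m)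
    (hmq : m < q) (hq : ∀ i, m < i → p i ≤ p q) {i j : ι} (hi : q ≤ i) (hij : i < j) :
    p j < p i := by
  have inj := hp.inj
  have := hp.av4312 m q i j
  have := hq j
  have := hm q
  grind +splitImp

/-- Let `p q` be the largest entry after the maximum `p m`, with `q` not last. Then the least entry
strictly between `m` and `q` is below the last entry. -/
theorem min_lt_last (hp : IsSimpleAvoider p) [Finite ι] (hz : ∀ i, i ≤ z) (hm : ∀ i, p i ≤ p m)
    (hmq : m < q) (hq : ∀ i, m < i → p i ≤ p q) (hqz : q < z) (hu : m < u) (huq : u < q)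
    (humin : ∀ i, m < i → i < q → p u ≤ p i) : p u < p z := by
  have inj := hp.inj
  have hQ := @decreasing_after _ _ _ _ _ _ _ hp hm hmq hq
  by_contra hn
  have hne : ∃ k, k < m ∧ p k < p u := by
    -- otherwise the last entry is the minimum, and the other entries form an interval
    by_contra hne
    push Not at hne
    obtain ⟨k, hk, s, t, hs, ht, h⟩ := hp.split (fun k => k ≠ z) u q z (by grind) (by grind)
      (by grind) (by grind)
    have := hz t
    have := hz s
    have := hne s
    have := humin s
    have := hQ (i := s) (j := z)
    have := hm u
    grind +splitImp
  obtain ⟨v, hv, hvmax⟩ := Set.exists_max_image {k | k < m ∧ p k < p u} id (Set.toFinite _) hne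
  simp only [Set.mem_ofPred_eq, id] at hv hvmax
  have hbig : ∀ w, w < v → p u < p w → p q < p w := by
    intro w hw
    have := hp.av3124 w v u q
    grind +splitImp
  -- The interval consists of the values from `p u` to `p q` if some `w` as below exists, and of
  -- all values from `p u` on otherwise.
  by_cases hw : ∃ w, w < v ∧ p u < p w
  · obtain ⟨w, hwv, hw⟩ := hw
    have hright : ∀ s, p u ≤ p s → p s ≤ p q → m < s := by
      intro s
      have := hbig s
      have := hbig w
      have := hp.av3124 w v s m
      have := hm q
      have := hm w
      grind +splitImp
    obtain ⟨k, hk, s, t, hs, ht, h⟩ := hp.split (fun k => p u ≤ p k ∧ p k ≤ p q) u q m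
      (by grind) (by grind) (by grind) (by grind)
    have := hright s
    have := humin k
    have := hq k
    have := hQ (i := k) (j := t)
    grind +splitImp
  · obtain ⟨k, hk, s, t, hs, ht, h⟩ := hp.split (fun k => p u ≤ p k) u q v
      (by grind) (by grind) (by grind) (by grind)
    have := humin k
    have := hQ (i := k) (j := t)
    have := hvmax k
    have := hm u
    grind +splitImp

/-- The case in which the entries after the maximum are not decreasing and the largest of them is
not the last entry. -/
theorem exists_isGridding_of_lt_last (hp : IsSimpleAvoider p) [Finite ι] (hz : ∀ i, i ≤ z)
    (hm : ∀ i, p i ≤ p m) (hmq : m < q) (hq : ∀ i, m < i → p i ≤ p q) (hqz : q < z) (hu : m < u)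
    (huq : u < q) (humin : ∀ i, m < i → i < q → p u ≤ p i)
    (ha : ∀ i, i < a → p i < p z) (hza : p z ≤ p a) :
    ∃ col row, IsGridding M₁ p col row := by
  have hpre := @increasing_of_lt_last _ _ _ _ _ _ _ hp hz ha
  have inj := hp.inj
  have hQ := @decreasing_after _ _ _ _ _ _ _ hp hm hmq hq
  have huz := hp.min_lt_last hz hm hmq hq hqz hu huq humin
  have hQz : ∀ k, q ≤ k → p z ≤ p k := by
    intro k hk
    have := hQ (i := k) (j := z)
    have := hz k
    grind +splitImp
  have hP : ∀ t, m < t → t < q → p t < p z := by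
    -- for a violation `t` of least value, the values from `p t` to `p q` form an interval
    by_contra! hP
    obtain ⟨t, hmt, htq, hzt⟩ := hP
    obtain ⟨t, ht, htmin⟩ := Set.exists_min_image {t | m < t ∧ t < q ∧ p z ≤ p t} p
      (Set.toFinite _) ⟨t, hmt, htq, hzt⟩
    simp only [Set.mem_ofPred_eq] at ht htmin
    have hut : u < t := by
      have := hp.av4312 m t u z
      have := hm t
      grind +splitImp
    obtain ⟨k, hk, s, r, hs, hr, h⟩ := hp.split (fun k => p t ≤ p k ∧ p k ≤ p q) t q m
      (by grind) (by grind) (by grind) (by grind)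
    have := hp.av3124 s u t q
    have := hp.av4312 m s k z
    have := htmin k
    have := hQ (i := k) (j := r)
    have := hq k
    have := hm s
    have := hm q
    have := hz k
    grind +splitImp
  obtain ⟨w, hwm, hzw, hwq⟩ : ∃ w, w < m ∧ p z < p w ∧ p w < p q := by
    -- otherwise the values from `p z` to `p q` form an interval of entries at the end
    by_contra! hw
    obtain ⟨k, hk, s, t, hs, ht, h⟩ := hp.split (fun k => p z ≤ p k ∧ p k ≤ p q) q z m
      (by grind) (by grind) (by grind) (by grind)
    have := hw s
    have := hP s
    have := hQz k
    have := hq k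
    have := hm q
    grind +splitImp
  have hinc : ∀ i j, i < j → j ≤ m → p z ≤ p i → p z ≤ p j → p i < p j := by
    intro i j
    have := hp.av4312 i j u z
    have := hm i
    grind +splitImp
  have haw : a ≤ w ∧ p a ≤ p w := by
    have := hinc a w
    have := ha w
    grind +splitImp
  refine exists_isGridding_M₁ (a := a) (c := p z) (fun k => q ≤ k) (by grind) ha hQz
    (fun i j => hpre) ?_ ?_ (fun i j => hQ)
  · intro i j
    have := hp.av3124 a i j q
    grind +splitImp
  · intro i j
    have := hinc i j
    have := hP j
    grind +splitImp

/-- The case in which the entries after the maximum are not decreasing and the largest of them is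
the last entry. -/
theorem exists_isGridding_of_eq_last (hp : IsSimpleAvoider p) [Finite ι] (hz : ∀ i, i ≤ z)
    (hm : ∀ i, p i ≤ p m) (hmz : m < z) (hq : ∀ i, m < i → p i ≤ p z) (hu : m < u)
    (huz : u < z) (ha : ∀ i, i < a → p i < p z) (hza : p z ≤ p a) :
    ∃ col row, IsGridding M₂ p col row := by
  have hpre := @increasing_of_lt_last _ _ _ _ _ _ _ hp hz ha
  have inj := hp.inj
  have hupz : p u < p z := by
    have := hq u
    grind
  have hpm : p z < p m := by
    have := hm z
    grind
  have ham : a ≤ m := by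
    have := ha m
    grind
  have hL : ∀ i j, a < i → i < j → j ≤ m → p i ≤ p z → p j ≤ p z → p j < p i := by
    intro i j
    have := hp.av3124 a i j m
    have := hm a
    grind +splitImp
  have hpa : p z < p a := by grind
  have hU : ∀ i j, i < j → j ≤ m → p z < p i → p z < p j → p i < p j := by
    intro i j
    have := hp.av4312 i j u z
    have := hm i
    grind +splitImp
  -- upper ends of ascents among the entries after `a` with value at most `p z`
  let top : ι → Prop := fun k => p k ≤ p z ∧ ∃ b, a < b ∧ b < k ∧ p b < p k
  have htop : ∀ k, top k ↔ p k ≤ p z ∧ ∃ b, a < b ∧ b < k ∧ p b < p k := fun k => Iff.rfl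
  obtain ⟨h, hh, hmin⟩ := Set.exists_min_image {k | top k} p (Set.toFinite _)
    ⟨z, le_rfl, u, by grind, huz, hupz⟩
  simp only [Set.mem_ofPred_eq] at hh hmin
  clear_value top
  obtain ⟨hhz, b, hab, hbh, hpbh⟩ := (htop h).1 hh
  have hmk : ∀ k, top k → m < k := by
    intro k hk
    obtain ⟨hkz, c, hac, hck, hpck⟩ := (htop k).1 hk
    have := hL c k
    grind +splitImp
  have htop_of : ∀ k, a < k → p h ≤ p k → p k ≤ p z → top k := by
    intro k hak hhk hkz
    have := hp.av3124 k b h z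
    have := hz h
    have := (htop k).2
    grind +splitImp
  have htop_le : ∀ b' k, a < b' → b' < k → p b' < p k → p k ≤ p z → p h ≤ p k :=
    fun b' k h1 h2 h3 h4 => hmin k ((htop k).2 ⟨h4, b', h1, h2, h3⟩)
  have htop_inc : ∀ i j, i < j → top i → top j → p i < p j := by
    intro i j hij hi hj
    obtain ⟨hjz, c, hac, hcj, hpcj⟩ := (htop j).1 hj
    obtain ⟨hiz, -⟩ := (htop i).1 hi
    have hmi := hmk i hi
    by_contra hn
    have h1 := hp.av3124 i c j z
    have h2 := hz j
    have h3 : c < i → False := fun hci => hp.false_of_132 hm hq hmi hci hij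
      (by grind) hpcj (by grind) (fun k hck hkm hkz => hL c k hac hck hkm (by grind) hkz)
    grind +splitImp
  clear htop hmin
  -- the bottom row is bounded by the largest entry after `m` below `p h`
  refine exists_isGridding_M₂ (c := p z) (h := p h) (m := m) (a := a)
    (fun k => ∃ v, m < v ∧ p v < p h ∧ p k ≤ p v) hhz (by grind) (by grind) ?_ ?_ ?_
    (fun i j => hpre) ?_ (by grind) ?_ ?_
  · intro i hi
    have := hp.av3124 i b h z
    have := ha i
    have := hz h
    grind +splitImp
  · intro i hai him
    have := htop_of i
    have := hmk i
    refine ⟨?_, by grind⟩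
    rintro ⟨v, hmv, hvh, hiv⟩
    have := htop_le i v
    grind +splitImp
  · intro i hi
    exact ⟨hq i hi, fun hih => ⟨i, hi, hih, le_rfl⟩⟩
  · intro i j
    have := hL i j
    grind
  · intro i j
    have := htop_le i j
    grind
  · intro i j hmi hij hi hj
    exact htop_inc i j hij (htop_of i (by grind) hi (hq i hmi))
      (htop_of j (by grind) hj (hq j (by grind)))

theorem exists_isGridding [Finite ι] [Nonempty ι] (hp : IsSimpleAvoider p) :
    (∃ col row, IsGridding M₁ p col row) ∨ ∃ col row, IsGridding M₂ p col row := by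
  obtain ⟨z, hz⟩ := Finite.exists_max (id : ι → ι)
  obtain ⟨m, hm⟩ := Finite.exists_max p
  simp only [id] at hz
  obtain ⟨a, hza, hamin⟩ := Set.exists_min_image {k | p z ≤ p k} id (Set.toFinite _) ⟨z, le_rfl⟩
  simp only [Set.mem_ofPred_eq, id] at hza hamin
  have ha : ∀ i, i < a → p i < p z := by grind
  by_cases hR : ∀ i j, m < i → i < j → p j < p i
  · exact .inl (hp.exists_isGridding_of_decreasing hz hm hR ha hza)
  push Not at hR
  obtain ⟨i, j, hmi, hij, hpij⟩ := hR
  obtain ⟨q, hmq, hq⟩ := Set.exists_max_image {k | m < k} p (Set.toFinite _) ⟨i, hmi⟩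
  simp only [Set.mem_ofPred_eq] at hmq hq
  have hiq : i < q := by
    have := hp.decreasing_after hm hmq hq (i := i) (j := j)
    grind
  obtain hqz | hqz := (hz q).lt_or_eq
  · obtain ⟨u, hu, humin⟩ := Set.exists_min_image {k | m < k ∧ k < q} p (Set.toFinite _)
      ⟨i, hmi, hiq⟩
    exact .inl (hp.exists_isGridding_of_lt_last hz hm hmq hq hqz hu.1 hu.2
      (fun k h1 h2 => humin k ⟨h1, h2⟩) ha hza)
  · subst hqz
    exact .inr (hp.exists_isGridding_of_eq_last hz hm hmq hq hmi hiq ha hza)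

end IsSimpleAvoider

/-! ### Application to permutations -/

theorem exists_eq_Icc {n : ℕ} {I : Finset (Fin n)} (hI : I.Nonempty)
    (h : ∀ k, ∀ a ∈ I, ∀ b ∈ I, a < k → k < b → k ∈ I) : ∃ a b, I = Finset.Icc a b := by
  refine ⟨I.min' hI, I.max' hI, ?_⟩
  ext k
  rw [Finset.mem_Icc]
  refine ⟨fun hk => ⟨I.min'_le k hk, I.le_max' k hk⟩, fun ⟨h1, h2⟩ => ?_⟩
  rcases h1.eq_or_lt with h1 | h1
  · exact h1 ▸ I.min'_mem hI
  rcases h2.eq_or_lt with h2 | h2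
  · exact h2 ▸ I.max'_mem hI
  exact h k _ (I.min'_mem hI) _ (I.max'_mem hI) h1 h2

theorem IsSimple.split {π : Permutation} (hπ : IsSimple π) (S : Fin π.1 → Prop)
    (i j t : Fin π.1) (hi : S i) (hj : S j) (hij : i ≠ j) (ht : ¬ S t) :
    ∃ k, ¬ S k ∧ ∃ a b, S a ∧ S b ∧ (a < k ∧ k < b ∨ π.2 a < π.2 k ∧ π.2 k < π.2 b) := by
  classical
  by_contra! hn
  let I : Finset (Fin π.1) := Finset.univ.filter S
  have hI : ∀ k, k ∈ I ↔ S k := fun k => by simp [I]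
  have hne : I.Nonempty := ⟨i, (hI i).2 hi⟩
  have hint : IsInterval π I := by
    refine ⟨hne, exists_eq_Icc hne fun k a ha b hb h1 h2 => ?_,
      exists_eq_Icc (hne.image _) fun y _ ha _ hb h1 h2 => ?_⟩
    · rw [hI] at ha hb ⊢
      by_contra hk
      exact absurd h2 (not_lt.2 ((hn k hk a b ha hb).1 h1))
    · obtain ⟨a, ha', rfl⟩ := Finset.mem_image.1 ha
      obtain ⟨b, hb', rfl⟩ := Finset.mem_image.1 hb
      obtain ⟨k, rfl⟩ := π.2.surjective y
      refine Finset.mem_image_of_mem _ ?_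
      rw [hI] at ha' hb' ⊢
      by_contra hk
      exact absurd h2 (not_lt.2 ((hn k hk a b ha' hb').2 h1))
  rcases hπ I hint with h | h
  · exact hij (Finset.card_le_one.1 h.le i ((hI i).2 hi) j ((hI j).2 hj))
  · have : I = Finset.univ := Finset.eq_univ_of_card I (by simpa using h)
    exact ht ((hI t).1 (this ▸ Finset.mem_univ t))

theorem IsSimple.isSimpleAvoider {π : Permutation} (hπ : IsSimple π)
    (hav : π ∈ Av {p3124, p4312}) : IsSimpleAvoider π.2 where
  inj := π.2.injective
  av3124 i j k l hij hjk hkl h1 h2 h3 :=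
    hav p3124 (by simp) (contains_p3124_iff.2 ⟨i, j, k, l, hij, hjk, hkl, h1, h2, h3⟩)
  av4312 i j k l hij hjk hkl h1 h2 h3 :=
    hav p4312 (by simp) (contains_p4312_iff.2 ⟨i, j, k, l, hij, hjk, hkl, h1, h2, h3⟩)
  split := hπ.split

theorem IsSimple.mem_G₁_union_G₂ {π : Permutation} (hπ : IsSimple π)
    (hav : π ∈ Av {p3124, p4312}) : π ∈ G₁ ∪ G₂ := by
  rcases isEmpty_or_nonempty (Fin π.1) with h | h
  · exact .inl ⟨isEmptyElim, isEmptyElim, fun i => isEmptyElim i, isEmptyElim⟩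
  · rcases (hπ.isSimpleAvoider hav).exists_isGridding with ⟨col, row, hg⟩ | ⟨col, row, hg⟩
    · exact .inl hg.mem_G₁
    · exact .inr hg.mem_G₂

end PermClass

theorem theorem4p1 :
    PermClass.Si (PermClass.Av {PermClass.p3124, PermClass.p4312}) =
      PermClass.Si (PermClass.G₁ ∪ PermClass.G₂) := by
  ext π
  refine ⟨fun ⟨hav, hs⟩ => ⟨hs.mem_G₁_union_G₂ hav, hs⟩, ?_⟩
  rintro ⟨h | h, hs⟩
  · exact ⟨PermClass.G₁_subset_Av h, hs⟩
  · exact ⟨PermClass.G₂_subset_Av h, hs⟩
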